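/- Let $p$ be a polynomial of degree $d$ with real coefficients in noncommuting variables $x=(x_1,\dots,x_g)$, and suppose that $p$ is symmetric, $p^T=p$, where $T$ is the linear involution that reverses words and fixes each variable (for matrices and vectors of polynomials, $T$ transposes and applies the involution to every entry). Let $p'(x)[h]$ and $p''(x)[h]$ be the first and second formal directional derivatives of $p$ in the direction of the noncommuting variables $h=(h_1,\dots,h_g)$; $p'(x)[h]$ is the coefficient of $t$ in $p(x+th)-p(x)$, and $p''(x)[h]$ is obtained by differentiating $p'(x)[h]$ in the same way with $h$ held fixed. For $j\ge 0$ let $V_j(x)[h]$ be the column vector of height $g^{j+1}$ with $$V_j(x)[h]^T=\underbrace{[x_1\ \cdots\ x_g]\otimes\cdots\otimes[x_1\ \cdots\ x_g]}_{j\text{ times}}\otimes[h_1\ \cdots\ h_g].$$ Then there are a unique family of column vectors $\psi_s(x)$, $0\le s\le d-1$, of height $g^{s+1}$ and a unique family of matrices $Z_{ij}(x)$, $0\le i,j\le d-2$, of size $g^{i+1}\times g^{j+1}$ with $Z_{ij}=0$ for $i+j>d-2$, with polynomials in $x$ as entries, such that $$p'(x)[h]=\sum_{s=0}^{d-1}\psi_s(x)^T\,V_s(x)[h]\qquad\text{and}\qquad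 p''(x)[h]=\sum_{i,j=0}^{d-2}V_i(x)[h]^T\,Z_{ij}(x)\,V_j(x)[h].$$ With the convention $Z_{ij}=0$ whenever $i+j>d-2$ (in particular $Z_{0,d-1}=0$), they are related by $$\psi_s(x)^T=\tfrac12\,[x_1\ \cdots\ x_g]\,Z_{0s}(x)+\psi_s(0)^T\qquad\text{for } s=0,\dots,d-1.$$ -/

import Mathlib

open scoped Matrix

namespace NCPoly

/-- The nc polynomials `ℝ⟨x⟩` in `g` noncommuting variables. Its `star` is the involution `ᵀ` that
fixes the variables and reverses words. -/
abbrev NC (g : ℕ) : Type := FreeAlgebra ℝ (Fin g)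

/-- The nc polynomials `ℝ⟨x, h⟩` in the `2g` variables `x₁, …, x_g` (`Sum.inl`) and
`h₁, …, h_g` (`Sum.inr`), with the analogous involution. -/
abbrev NC2 (g : ℕ) : Type := FreeAlgebra ℝ (Fin g ⊕ Fin g)

/-- Words of length `n` in `g` letters. They index the `g ^ n` entries of an `n`-fold Kronecker
product (the positions `1, …, g ^ n` are the words in lexicographic order). -/
abbrev Word (g n : ℕ) : Type := Fin n → Fin g

/-- The variable `x_j` in `ℝ⟨x, h⟩`. -/
noncomputable def X {g : ℕ} (j : Fin g) : NC2 g := FreeAlgebra.ι ℝ (Sum.inl j)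

/-- The variable `h_j` in `ℝ⟨x, h⟩`. -/
noncomputable def H {g : ℕ} (j : Fin g) : NC2 g := FreeAlgebra.ι ℝ (Sum.inr j)

/-- The inclusion of `ℝ⟨x⟩` in `ℝ⟨x, h⟩`. -/
noncomputable def incl (g : ℕ) : NC g →ₐ[ℝ] NC2 g := FreeAlgebra.lift ℝ X

/-- The degree: the maximal length of a monomial with nonzero coefficient (`0` for `p = 0`). -/
noncomputable def degree {g : ℕ} (p : NC g) : ℕ :=
  ((FreeAlgebra.basisFreeMonoid ℝ (Fin g)).repr p).support.sup FreeMonoid.length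

/-- The value `p(0) ∈ ℝ` of an nc polynomial at `x = 0`. -/
noncomputable def evalZero {g : ℕ} (p : NC g) : ℝ := FreeAlgebra.lift ℝ (fun _ => (0 : ℝ)) p

/-- The elements of `FreeAlgebra.basisFreeMonoid` are the monomials. -/
theorem basisFreeMonoid_apply {ι : Type} (m : FreeMonoid ι) :
    FreeAlgebra.basisFreeMonoid ℝ ι m = (m.toList.map (FreeAlgebra.ι ℝ)).prod := by
  simp [FreeAlgebra.basisFreeMonoid, FreeAlgebra.equivMonoidAlgebraFreeMonoid,
    MonoidAlgebra.lift_apply, FreeMonoid.lift_apply]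

/-- The directional derivative of a monomial in `x, h` with respect to `x` in the direction `h`:
the sum over all occurrences of a letter `x_j` of the monomial in which this
occurrence is replaced by `h_j`. The letters `h_j` are held fixed. -/
noncomputable def derivMonomial {g : ℕ} : List (Fin g ⊕ Fin g) → NC2 g
  | [] => 0
  | Sum.inl j :: m => H j * (m.map (FreeAlgebra.ι ℝ)).prod + X j * derivMonomial m
  | Sum.inr j :: m => H j * derivMonomial m

/-- The directional derivative `q ↦ q'(x)[h]` on `ℝ⟨x, h⟩`, extended linearly from monomials. -/
noncomputable def dirDeriv {g : ℕ} : NC2 g →ₗ[ℝ] NC2 g :=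
  (FreeAlgebra.basisFreeMonoid ℝ (Fin g ⊕ Fin g)).constr ℝ fun m => derivMonomial m.toList

/-- The first derivative `p'(x)[h]`. -/
noncomputable def grad {g : ℕ} (p : NC g) : NC2 g := dirDeriv (incl g p)

/-- The Hessian `p''(x)[h]`. -/
noncomputable def hessian {g : ℕ} (p : NC g) : NC2 g := dirDeriv (dirDeriv (incl g p))

/-- The row vector `V_j(x)[h]ᵀ = [x₁ ⋯ x_g]_j ⊗ [h₁ ⋯ h_g]`: its entry at the word
`(i₁, …, i_j, i)` is `x_{i₁} ⋯ x_{i_j} h_i`. -/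
noncomputable def borderRow (g j : ℕ) (w : Word g (j + 1)) : NC2 g :=
  (List.ofFn fun k : Fin j => X (w k.castSucc)).prod * H (w (Fin.last j))

/-- `V_0(x)[h]ᵀ = [h₁ ⋯ h_g]`. -/
theorem borderRow_zero (g : ℕ) (w : Word g 1) : borderRow g 0 w = H (w 0) := by
  simp [borderRow]

/-- `V_{j+1}(x)[h]ᵀ = [x₁ ⋯ x_g] ⊗ V_j(x)[h]ᵀ`. -/
theorem borderRow_succ (g j : ℕ) (b : Fin g) (w : Word g (j + 1)) :
    borderRow g (j + 1) (Fin.cons b w) = X b * borderRow g j w := by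
  simp only [borderRow, List.ofFn_succ, List.prod_cons, mul_assoc]
  rfl

/-- The `j`-th component `V_j(x)[h]` of the border vector, the transpose of `borderRow g j`: the
involution is applied to each entry, so that its entry at `(i₁, …, i_j, i)` is
`h_i x_{i_j} ⋯ x_{i₁}`. -/
noncomputable def border (g j : ℕ) (w : Word g (j + 1)) : NC2 g := star (borderRow g j w)

/-- The row vector `[x₁ ⋯ x_g]`. -/
noncomputable def xRow (g : ℕ) (w : Word g 1) : NC g := FreeAlgebra.ι ℝ (w 0)

/-- A family of column vectors `ψ_s` of nc polynomials in `x`, with `ψ_s` of height `g ^ (s + 1)`. -/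
abbrev ColFamily (g : ℕ) : Type := (s : ℕ) → Word g (s + 1) → NC g

/-- A family of matrices `Z_{ij}` of nc polynomials in `x`, with `Z_{ij}` of size
`g ^ (i + 1) × g ^ (j + 1)`. -/
abbrev BlockFamily (g : ℕ) : Type :=
  (i j : ℕ) → Matrix (Word g (i + 1)) (Word g (j + 1)) (NC g)

/-- The transpose `ψᵀ` of a column vector of nc polynomials: the involution is applied to each
entry. -/
noncomputable def colTranspose {g n : ℕ} (ψ : Word g n → NC g) : Word g n → NC g :=
  fun w => star (ψ w)

/-- The value at `x = 0` of a vector of nc polynomials, as a vector of constant polynomials. -/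
noncomputable def vecZero {g n : ℕ} (ψ : Word g n → NC g) : Word g n → NC g :=
  fun w => algebraMap ℝ (NC g) (evalZero (ψ w))

/-- The `ψ_s`, `s = 0, …, d - 1`, are coefficients of `p'(x)[h]` with respect to the border vectors,
where `d` is the degree of `p`: `p'(x)[h] = ∑_{s=0}^{d-1} ψ_s(x)ᵀ V_s(x)[h]`.
The unused members `ψ_s`, `s ≥ d`, are set to `0`. -/
def IsGradCoeff {g : ℕ} (p : NC g) (ψ : ColFamily g) : Prop :=
  (∀ s, degree p ≤ s → ψ s = 0) ∧
  grad p = ∑ s ∈ Finset.range (degree p),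
    (fun w => incl g (colTranspose (ψ s) w)) ⬝ᵥ border g s

/-- The `Z_{ij}`, `0 ≤ i, j ≤ d - 2`, are the blocks of a middle matrix of `p''(x)[h]`, where `d` is
the degree of `p`: `p''(x)[h] = ∑_{i,j=0}^{d-2} V_i(x)[h]ᵀ Z_{ij}(x) V_j(x)[h]`, and
`Z_{ij} = 0` for `i + j > d - 2`. -/
def IsMiddleMatrix {g : ℕ} (p : NC g) (Z : BlockFamily g) : Prop :=
  (∀ i j, degree p < i + j + 2 → Z i j = 0) ∧
  hessian p = ∑ i ∈ Finset.range (degree p - 1), ∑ j ∈ Finset.range (degree p - 1),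
    (borderRow g i ᵥ* (Z i j).map (incl g)) ⬝ᵥ border g j

end NCPoly

/-! Write `p = p(0) + ∑ x_a p_a`, where `p_a = lead a p`. The product rule gives `p' = ∑ h_a p_a + ∑
x_a p_a'` and `p'' = ∑ h_a (2 p_a') + ∑ x_a p_a''`. Iterating expands both along the rows `V_sᵀ`,
with coefficients `leadWord w p` and `2 (leadWord w p)'`. The involution commutes with
differentiation, so for symmetric `p` transposing puts `V_s` on the right: the entry of `ψ_s` at `w`
is `leadWord w p`, and `V_j` at `w` is preceded by `2 (ψ_jᵀ)'`. Expanding this gradient on the left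
gives `Z_{ij} = 2 · leadWord v (ψ_jᵀ)`. For `i = 0` this strips one letter, so `[x] Z_{0s} = 2 (ψ_sᵀ
- ψ_s(0)ᵀ)`, which is the stated relation. Uniqueness holds because the prefix up to the first `h`
determines the entry of `V_sᵀ`. -/

namespace NCPoly

/-! ### Stripping leading letters, and the filtration by degree. -/

section FreeAlgebra

variable {α : Type}

/-- The monomial with the given list of letters. -/
noncomputable def monomial (m : List α) : FreeAlgebra ℝ α := (m.map (FreeAlgebra.ι ℝ)).prod

@[simp] theorem monomial_nil : monomial ([] : List α) = 1 := rfl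

@[simp] theorem monomial_cons (a : α) (m : List α) :
    monomial (a :: m) = FreeAlgebra.ι ℝ a * monomial m := by
  simp [monomial]

theorem basis_eq_monomial (m : FreeMonoid α) :
    FreeAlgebra.basisFreeMonoid ℝ α m = monomial m.toList := basisFreeMonoid_apply m

theorem star_monomial (m : List α) : star (monomial m) = monomial m.reverse := by
  induction m with
  | nil => simp
  | cons a m ih => rw [monomial_cons, star_mul, ih]; simp [monomial]

theorem monomial_induction {motive : FreeAlgebra ℝ α → Prop}
    (mon : ∀ m, motive (monomial m))
    (add : ∀ p q, motive p → motive q → motive (p + q))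
    (smul : ∀ (c : ℝ) p, motive p → motive (c • p)) (p : FreeAlgebra ℝ α) : motive p := by
  have hp : p ∈ Submodule.span ℝ (Set.range (FreeAlgebra.basisFreeMonoid ℝ α)) := by
    simp [(FreeAlgebra.basisFreeMonoid ℝ α).span_eq]
  induction hp using Submodule.span_induction with
  | mem x hx =>
    obtain ⟨m, rfl⟩ := hx
    rw [basis_eq_monomial]
    exact mon _
  | zero => simpa using smul 0 _ (mon [])
  | add x y _ _ hx hy => exact add _ _ hx hy
  | smul c x _ hx => exact smul c _ hx

open Classical in
/-- Removal of the leading letter `a` from a monomial; the monomials that do not begin with `a`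
are sent to `0`. -/
noncomputable def leadList (a : α) : List α → FreeAlgebra ℝ α
  | [] => 0
  | b :: m => if b = a then monomial m else 0

/-- The linear extension of `leadList a`. -/
noncomputable def lead (a : α) : FreeAlgebra ℝ α →ₗ[ℝ] FreeAlgebra ℝ α :=
  (FreeAlgebra.basisFreeMonoid ℝ α).constr ℝ fun m => leadList a m.toList

theorem lead_monomial (a : α) (m : List α) : lead a (monomial m) = leadList a m := by
  have := (FreeAlgebra.basisFreeMonoid ℝ α).constr_basis ℝ
    (fun m => leadList a m.toList) (FreeMonoid.ofList m)
  rwa [basis_eq_monomial] at this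

theorem lead_ι_mul_self (a : α) (y : FreeAlgebra ℝ α) :
    lead a (FreeAlgebra.ι ℝ a * y) = y := by
  induction y using monomial_induction with
  | mon m => rw [← monomial_cons, lead_monomial]; simp [leadList]
  | add p q hp hq => rw [mul_add, map_add, hp, hq]
  | smul c p hp => rw [mul_smul_comm, map_smul, hp]

theorem lead_ι_mul_of_ne {a b : α} (h : b ≠ a) (y : FreeAlgebra ℝ α) :
    lead a (FreeAlgebra.ι ℝ b * y) = 0 := by
  induction y using monomial_induction with
  | mon m => rw [← monomial_cons, lead_monomial]; simp [leadList, h]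
  | add p q hp hq => rw [mul_add, map_add, hp, hq, add_zero]
  | smul c p hp => rw [mul_smul_comm, map_smul, hp, smul_zero]

theorem lead_sum_ι_mul [Fintype α] (a : α) (y : α → FreeAlgebra ℝ α) :
    lead a (∑ b, FreeAlgebra.ι ℝ b * y b) = y a := by
  rw [map_sum, Finset.sum_eq_single a, lead_ι_mul_self]
  · intro b _ hb
    exact lead_ι_mul_of_ne hb _
  · simp

/-- Removal of the leading word `w`. -/
noncomputable def leadWord : (n : ℕ) → (Fin n → α) → FreeAlgebra ℝ α →ₗ[ℝ] FreeAlgebra ℝ α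
  | 0, _ => LinearMap.id
  | n + 1, w => leadWord n (Fin.tail w) ∘ₗ lead (w 0)

theorem leadWord_cons (n : ℕ) (a : α) (w : Fin n → α) (p : FreeAlgebra ℝ α) :
    leadWord (n + 1) (Fin.cons a w : Fin (n + 1) → α) p = leadWord n w (lead a p) := by
  simp [leadWord]

/-- The polynomials of degree less than `n`. -/
noncomputable def degLT (α : Type) (n : ℕ) : Submodule ℝ (FreeAlgebra ℝ α) :=
  Submodule.span ℝ (monomial '' {m : List α | m.length < n})

theorem monomial_mem_degLT {m : List α} {n : ℕ} (h : m.length < n) :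
    monomial m ∈ degLT α n := Submodule.subset_span ⟨m, h, rfl⟩

theorem degLT_mono {m n : ℕ} (h : m ≤ n) : degLT α m ≤ degLT α n :=
  Submodule.span_mono (Set.image_mono fun _ hl => lt_of_lt_of_le hl h)

theorem degLT_zero : degLT α 0 = ⊥ := by
  simp [degLT]

theorem exists_algebraMap_of_mem_degLT_one {p : FreeAlgebra ℝ α} (hp : p ∈ degLT α 1) :
    ∃ c : ℝ, p = algebraMap ℝ _ c := by
  have h : {m : List α | m.length < 1} = {[]} := by
    ext m
    simp
  rw [degLT, h, Set.image_singleton, monomial_nil, Submodule.mem_span_singleton] at hp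
  obtain ⟨c, rfl⟩ := hp
  exact ⟨c, (Algebra.algebraMap_eq_smul_one c).symm⟩

theorem star_mem_degLT {n : ℕ} {p : FreeAlgebra ℝ α} (hp : p ∈ degLT α n) :
    star p ∈ degLT α n := by
  induction hp using Submodule.span_induction with
  | mem x hx =>
    obtain ⟨m, hm, rfl⟩ := hx
    rw [star_monomial]
    exact monomial_mem_degLT (by simpa using hm)
  | zero => simp
  | add x y _ _ hx hy => rw [star_add]; exact add_mem hx hy
  | smul c x _ hx =>
    rw [Algebra.smul_def, star_mul, FreeAlgebra.star_algebraMap, ← Algebra.commutes,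
      ← Algebra.smul_def]
    exact Submodule.smul_mem _ c hx

theorem lead_mem_degLT {n : ℕ} (a : α) {p : FreeAlgebra ℝ α} (hp : p ∈ degLT α (n + 1)) :
    lead a p ∈ degLT α n := by
  induction hp using Submodule.span_induction with
  | mem x hx =>
    obtain ⟨m, hm, rfl⟩ := hx
    rw [lead_monomial]
    cases m with
    | nil => exact zero_mem _
    | cons b m =>
      rw [leadList]
      split_ifs
      · exact monomial_mem_degLT (by simpa using hm)
      · exact zero_mem _
  | zero => simp
  | add x y _ _ hx hy => rw [map_add]; exact add_mem hx hy
  | smul c x _ hx => rw [map_smul]; exact Submodule.smul_mem _ c hx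

theorem leadWord_mem_degLT {k : ℕ} (n : ℕ) (w : Fin n → α) {p : FreeAlgebra ℝ α}
    (hp : p ∈ degLT α (k + n)) : leadWord n w p ∈ degLT α k := by
  induction n generalizing p with
  | zero => exact hp
  | succ n ih => exact ih _ (lead_mem_degLT _ hp)

theorem leadWord_eq_zero {m n : ℕ} (w : Fin n → α) {p : FreeAlgebra ℝ α}
    (hp : p ∈ degLT α m) (h : m ≤ n) : leadWord n w p = 0 := by
  have := leadWord_mem_degLT (k := 0) n w (degLT_mono (by omega : m ≤ 0 + n) hp)
  simpa [degLT_zero] using this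

end FreeAlgebra

/-! ### Splitting by first letter, and the inclusion of ℝ⟨x⟩ in ℝ⟨x, h⟩. -/

section Decomposition

variable {g : ℕ}

theorem mem_degLT_degree (p : NC g) : p ∈ degLT (Fin g) (degree p + 1) := by
  have h := (FreeAlgebra.basisFreeMonoid ℝ (Fin g)).linearCombination_repr p
  rw [Finsupp.linearCombination_apply, Finsupp.sum] at h
  suffices hs : ∑ m ∈ ((FreeAlgebra.basisFreeMonoid ℝ (Fin g)).repr p).support,
      (FreeAlgebra.basisFreeMonoid ℝ (Fin g)).repr p m •
        FreeAlgebra.basisFreeMonoid ℝ (Fin g) m ∈ degLT (Fin g) (degree p + 1) by rwa [h] at hs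
  refine sum_mem fun m hm => Submodule.smul_mem _ _ ?_
  rw [basis_eq_monomial]
  exact monomial_mem_degLT (Nat.lt_succ_of_le (Finset.le_sup (f := FreeMonoid.length) hm))

theorem eq_evalZero_add_sum (p : NC g) :
    p = algebraMap ℝ (NC g) (evalZero p) + ∑ a, FreeAlgebra.ι ℝ a * lead a p := by
  induction p using monomial_induction with
  | mon m =>
    cases m with
    | nil =>
      simp only [lead_monomial, leadList, mul_zero]
      simp [evalZero]
    | cons b m =>
      have h : evalZero (monomial (b :: m)) = 0 := by simp [evalZero]
      rw [h, map_zero, zero_add, Finset.sum_eq_single b]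
      · rw [monomial_cons, lead_ι_mul_self]
      · intro a _ ha
        rw [monomial_cons, lead_ι_mul_of_ne ha.symm, mul_zero]
      · simp
  | add p q hp hq =>
    have h : evalZero (p + q) = evalZero p + evalZero q := by simp [evalZero]
    simp only [h, map_add, mul_add, Finset.sum_add_distrib]
    nth_rw 1 [hp, hq]
    abel
  | smul c p hp =>
    have h : evalZero (c • p) = c * evalZero p := by simp [evalZero]
    simp only [h, map_smul, map_mul, mul_smul_comm, ← Finset.smul_sum]
    nth_rw 1 [hp]
    rw [smul_add, ← Algebra.smul_def]

@[simp] theorem incl_ι (a : Fin g) : incl g (FreeAlgebra.ι ℝ a) = X a := by simp [incl]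

/-- Setting `h = 0` is a left inverse. -/
theorem incl_injective : Function.Injective (incl g) := by
  let r : NC2 g →ₐ[ℝ] NC g := FreeAlgebra.lift ℝ (Sum.elim (FreeAlgebra.ι ℝ) fun _ => 0)
  have h : r.comp (incl g) = AlgHom.id ℝ _ := by
    ext a
    simp [r, X]
  exact Function.LeftInverse.injective (g := r) fun p => DFunLike.congr_fun h p

@[simp] theorem star_X (a : Fin g) : star (X a) = X a := FreeAlgebra.star_ι _

@[simp] theorem star_H (a : Fin g) : star (H a) = H a := FreeAlgebra.star_ι _

theorem incl_star (p : NC g) : incl g (star p) = star (incl g p) := by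
  induction p using FreeAlgebra.induction with
  | grade0 r => simp
  | grade1 a => simp
  | mul p q hp hq => simp [hp, hq]
  | add p q hp hq => simp [hp, hq]

theorem star_smul_nc2 (c : ℝ) (y : NC2 g) : star (c • y) = c • star y := by
  rw [Algebra.smul_def, star_mul, FreeAlgebra.star_algebraMap, ← Algebra.commutes,
    ← Algebra.smul_def]

end Decomposition

/-! ### Product rule, compatibility with the involution, and recursions on the first letter. -/

section Derivative

variable {g : ℕ}

theorem dirDeriv_monomial (m : List (Fin g ⊕ Fin g)) :
    dirDeriv (monomial m) = derivMonomial m := by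
  have := (FreeAlgebra.basisFreeMonoid ℝ (Fin g ⊕ Fin g)).constr_basis ℝ
    (fun m => derivMonomial m.toList) (FreeMonoid.ofList m)
  rwa [basis_eq_monomial] at this

theorem dirDeriv_one : dirDeriv (1 : NC2 g) = 0 := dirDeriv_monomial []

theorem dirDeriv_algebraMap (c : ℝ) : dirDeriv (algebraMap ℝ (NC2 g) c) = 0 := by
  rw [Algebra.algebraMap_eq_smul_one, map_smul, dirDeriv_one, smul_zero]

theorem dirDeriv_X_mul (a : Fin g) (y : NC2 g) :
    dirDeriv (X a * y) = H a * y + X a * dirDeriv y := by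
  induction y using monomial_induction with
  | mon m => rw [X, ← monomial_cons, dirDeriv_monomial, dirDeriv_monomial]; rfl
  | add p q hp hq => simp only [mul_add, map_add, hp, hq]; abel
  | smul c p hp => simp only [mul_smul_comm, map_smul, hp, smul_add]

theorem dirDeriv_H_mul (a : Fin g) (y : NC2 g) :
    dirDeriv (H a * y) = H a * dirDeriv y := by
  induction y using monomial_induction with
  | mon m => rw [H, ← monomial_cons, dirDeriv_monomial, dirDeriv_monomial]; rfl
  | add p q hp hq => simp only [mul_add, map_add, hp, hq]
  | smul c p hp => simp only [mul_smul_comm, map_smul, hp]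

theorem dirDeriv_X (a : Fin g) : dirDeriv (X a) = H a := by
  simpa [dirDeriv_one] using dirDeriv_X_mul a 1

theorem dirDeriv_H (a : Fin g) : dirDeriv (H a) = 0 := by
  simpa [dirDeriv_one] using dirDeriv_H_mul a 1

theorem dirDeriv_mul (p q : NC2 g) :
    dirDeriv (p * q) = dirDeriv p * q + p * dirDeriv q := by
  induction p using monomial_induction with
  | mon m =>
    induction m with
    | nil => simp [dirDeriv_one]
    | cons a m ih =>
      rw [monomial_cons, mul_assoc]
      cases a with
      | inl a =>
        change dirDeriv (X a * _) = dirDeriv (X a * _) * _ + X a * _ * _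
        rw [dirDeriv_X_mul, dirDeriv_X_mul, ih]
        noncomm_ring
      | inr a =>
        change dirDeriv (H a * _) = dirDeriv (H a * _) * _ + H a * _ * _
        rw [dirDeriv_H_mul, dirDeriv_H_mul, ih]
        noncomm_ring
  | add p p' hp hp' => simp only [add_mul, map_add, hp, hp']; abel
  | smul c p hp => simp only [smul_mul_assoc, map_smul, hp, smul_add]

theorem dirDeriv_star (p : NC2 g) : dirDeriv (star p) = star (dirDeriv p) := by
  induction p using FreeAlgebra.induction with
  | grade0 r => simp [dirDeriv_algebraMap]
  | grade1 a =>
    cases a with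
    | inl a =>
      change dirDeriv (star (X a)) = star (dirDeriv (X a))
      rw [star_X, dirDeriv_X, star_H]
    | inr a =>
      change dirDeriv (star (H a)) = star (dirDeriv (H a))
      rw [star_H, dirDeriv_H, star_zero]
  | mul p q hp hq => simp only [star_mul, dirDeriv_mul, hp, hq, star_add]; abel
  | add p q hp hq => simp only [star_add, map_add, hp, hq]

theorem grad_star (p : NC g) : grad (star p) = star (grad p) := by
  rw [grad, incl_star, dirDeriv_star, grad]

theorem hessian_star (p : NC g) : hessian (star p) = star (hessian p) := by
  rw [hessian, incl_star, dirDeriv_star, dirDeriv_star, hessian]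

theorem grad_eq_sum_lead (p : NC g) :
    grad p = ∑ a, H a * incl g (lead a p) + ∑ a, X a * grad (lead a p) := by
  rw [grad]
  nth_rw 1 [eq_evalZero_add_sum p]
  simp only [map_add, AlgHom.commutes, dirDeriv_algebraMap, zero_add, map_sum, map_mul, incl_ι,
    dirDeriv_X_mul, Finset.sum_add_distrib, grad]

/-- The factor 2 arises because `h_a p_a'` occurs twice: from differentiating `p_a` in `h_a p_a`,
and `x_a` in `x_a p_a'`. -/
theorem hessian_eq_sum_lead (p : NC g) :
    hessian p = ∑ a, H a * ((2 : ℝ) • grad (lead a p)) + ∑ a, X a * hessian (lead a p) := by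
  change dirDeriv (grad p) = _
  rw [grad_eq_sum_lead]
  simp only [map_add, map_sum, dirDeriv_X_mul, dirDeriv_H_mul, ← Finset.sum_add_distrib]
  refine Finset.sum_congr rfl fun a _ => ?_
  rw [two_smul, mul_add, add_assoc]
  rfl

theorem grad_eq_zero_of_mem_degLT_one {p : NC g} (hp : p ∈ degLT (Fin g) 1) : grad p = 0 := by
  obtain ⟨c, rfl⟩ := exists_algebraMap_of_mem_degLT_one hp
  rw [grad, AlgHom.commutes, dirDeriv_algebraMap]

theorem hessian_eq_zero_of_mem_degLT_one {p : NC g} (hp : p ∈ degLT (Fin g) 1) :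
    hessian p = 0 := by
  change dirDeriv (grad p) = 0
  rw [grad_eq_zero_of_mem_degLT_one hp, map_zero]

end Derivative

/-! ### Expansions along border vectors and their uniqueness. -/

section Border

variable {g : ℕ}

theorem sum_borderRow_zero (F : Word g 1 → NC2 g) :
    ∑ w, borderRow g 0 w * F w = ∑ a, H a * F (fun _ => a) := by
  rw [← (Equiv.funUnique (Fin 1) (Fin g)).symm.sum_comp]
  refine Finset.sum_congr rfl fun a _ => ?_
  rw [borderRow_zero]
  rfl

theorem sum_word_succ {M : Type} [AddCommMonoid M] (n : ℕ) (F : Word g (n + 1) → M) :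
    ∑ w, F w = ∑ a, ∑ w : Word g n, F (Fin.cons a w) := by
  rw [← (Fin.consEquiv fun _ : Fin (n + 1) => Fin g).sum_comp, Fintype.sum_prod_type]
  rfl

theorem sum_borderRow_succ (n : ℕ) (F : (s : ℕ) → Word g (s + 1) → NC2 g) :
    ∑ s ∈ Finset.range (n + 1), ∑ w, borderRow g s w * F s w =
      ∑ a, H a * F 0 (fun _ => a) +
        ∑ a, X a * ∑ s ∈ Finset.range n, ∑ w, borderRow g s w * F (s + 1) (Fin.cons a w) := by
  rw [Finset.sum_range_succ', sum_borderRow_zero, add_comm]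
  congr 1
  simp only [sum_word_succ (_ + 1), borderRow_succ, mul_assoc, Finset.mul_sum]
  exact Finset.sum_comm

theorem sum_borderRow_injective (n : ℕ) (F G : (s : ℕ) → Word g (s + 1) → NC2 g)
    (h : ∑ s ∈ Finset.range n, ∑ w, borderRow g s w * F s w =
      ∑ s ∈ Finset.range n, ∑ w, borderRow g s w * G s w) :
    ∀ s < n, F s = G s := by
  induction n generalizing F G with
  | zero => simp
  | succ n ih =>
    rw [sum_borderRow_succ, sum_borderRow_succ] at h
    -- Both sides become sums over all `2g` letters. Stripping `h_a` then isolates the block `s =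
    -- 0`, and stripping `x_a` leaves the same identity with `n` in place of `n + 1`.
    have key (Y Z : Fin g → NC2 g) :
        ∑ a, H a * Y a + ∑ a, X a * Z a =
          ∑ b, FreeAlgebra.ι ℝ b * Sum.elim Z Y b := by
      rw [Fintype.sum_sum_type, add_comm]
      rfl
    rw [key, key] at h
    have h' (b) := congrArg (lead b) h
    simp only [lead_sum_ι_mul] at h'
    intro s hs
    funext w
    cases s with
    | zero =>
      have hw : w = fun _ => w 0 := by
        funext i
        exact congrArg w (Subsingleton.elim (α := Fin 1) i 0)
      rw [hw]
      exact h' (Sum.inr (w 0))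
    | succ s =>
      have := ih (fun s w' => F (s + 1) (Fin.cons (w 0) w'))
        (fun s w' => G (s + 1) (Fin.cons (w 0) w')) (h' (Sum.inl (w 0))) s (by omega)
      simpa using congrFun this (Fin.tail w)

theorem sum_border_injective (n : ℕ) (F G : (s : ℕ) → Word g (s + 1) → NC2 g)
    (h : ∑ s ∈ Finset.range n, ∑ w, F s w * border g s w =
      ∑ s ∈ Finset.range n, ∑ w, G s w * border g s w) :
    ∀ s < n, F s = G s := by
  intro s hs
  have h' := congrArg star h
  simp only [star_sum, star_mul, border, star_star] at h'
  funext w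
  exact star_injective (congrFun (sum_borderRow_injective n (fun s w => star (F s w))
    (fun s w => star (G s w)) h' s hs) w)

theorem grad_eq_sum_borderRow (n : ℕ) {p : NC g} (hp : p ∈ degLT (Fin g) (n + 1)) :
    grad p = ∑ s ∈ Finset.range n, ∑ w, borderRow g s w * incl g (leadWord (s + 1) w p) := by
  induction n generalizing p with
  | zero => simpa using grad_eq_zero_of_mem_degLT_one hp
  | succ n ih =>
    rw [sum_borderRow_succ n fun s w => incl g (leadWord (s + 1) w p), grad_eq_sum_lead]
    refine congrArg₂ (· + ·) rfl (Finset.sum_congr rfl fun a _ => ?_)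
    rw [ih (lead_mem_degLT a hp)]
    simp only [leadWord_cons]

/-- One block fewer than for the gradient: stripping `n + 1` letters leaves a constant, whose
gradient vanishes. -/
theorem hessian_eq_sum_borderRow (n : ℕ) {p : NC g} (hp : p ∈ degLT (Fin g) (n + 2)) :
    hessian p = ∑ s ∈ Finset.range n,
      ∑ w, borderRow g s w * ((2 : ℝ) • grad (leadWord (s + 1) w p)) := by
  induction n generalizing p with
  | zero =>
    rw [hessian_eq_sum_lead]
    simp [grad_eq_zero_of_mem_degLT_one (lead_mem_degLT _ hp),
      hessian_eq_zero_of_mem_degLT_one (lead_mem_degLT _ hp)]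
  | succ n ih =>
    rw [sum_borderRow_succ n fun s w => (2 : ℝ) • grad (leadWord (s + 1) w p),
      hessian_eq_sum_lead]
    refine congrArg₂ (· + ·) rfl (Finset.sum_congr rfl fun a _ => ?_)
    rw [ih (lead_mem_degLT a hp)]
    simp only [leadWord_cons]

theorem grad_eq_sum_border (n : ℕ) {p : NC g} (hp : p ∈ degLT (Fin g) (n + 1)) :
    grad p = ∑ s ∈ Finset.range n,
      ∑ w, incl g (star (leadWord (s + 1) w (star p))) * border g s w := by
  rw [← star_star (grad p), ← grad_star, grad_eq_sum_borderRow n (star_mem_degLT hp)]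
  simp only [star_sum, star_mul, border, incl_star]

theorem hessian_eq_sum_border (n : ℕ) {p : NC g} (hp : p ∈ degLT (Fin g) (n + 2)) :
    hessian p = ∑ s ∈ Finset.range n,
      ∑ w, ((2 : ℝ) • grad (star (leadWord (s + 1) w (star p)))) * border g s w := by
  rw [← star_star (hessian p), ← hessian_star, hessian_eq_sum_borderRow n (star_mem_degLT hp)]
  simp only [star_sum, star_mul, border, grad_star, star_smul_nc2]

end Border

/-! ### The coefficients `ψ_s` and `Z_{ij}`, their uniqueness and their relation. -/

section Coefficients

variable {g : ℕ}

/-- The vectors `ψ_s` of a symmetric polynomial: the entry of `ψ_s` at `w` collects the monomials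
that begin with `w`, with `w` removed. -/
noncomputable def gradCoeff (p : NC g) : ColFamily g := fun s w => leadWord (s + 1) w p

/-- The blocks `Z_{ij}` for a symmetric polynomial. -/
noncomputable def middleMatrix (p : NC g) : BlockFamily g :=
  fun i j v w => (2 : ℝ) • leadWord (i + 1) v (colTranspose (gradCoeff p j) w)

theorem isGradCoeff_gradCoeff {p : NC g} (hp : star p = p) : IsGradCoeff p (gradCoeff p) := by
  refine ⟨fun s hs => funext fun w => ?_, ?_⟩
  · exact leadWord_eq_zero w (mem_degLT_degree p) (by omega)
  · rw [grad_eq_sum_border _ (mem_degLT_degree p), hp]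
    rfl

theorem IsGradCoeff.unique {p : NC g} {ψ φ : ColFamily g} (hψ : IsGradCoeff p ψ)
    (hφ : IsGradCoeff p φ) : ψ = φ := by
  funext s
  rcases le_or_gt (degree p) s with hs | hs
  · rw [hψ.1 s hs, hφ.1 s hs]
  · have := sum_border_injective _ (fun s w => incl g (colTranspose (ψ s) w))
      (fun s w => incl g (colTranspose (φ s) w)) (hψ.2.symm.trans hφ.2) s hs
    funext w
    exact star_injective (incl_injective (congrFun this w))

theorem middle_form_eq (Z : BlockFamily g) (n : ℕ) :
    ∑ i ∈ Finset.range n, ∑ j ∈ Finset.range n,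
        (borderRow g i ᵥ* (Z i j).map (incl g)) ⬝ᵥ border g j =
      ∑ j ∈ Finset.range n, ∑ w,
        (∑ i ∈ Finset.range n, ∑ v, borderRow g i v * incl g (Z i j v w)) * border g j w := by
  rw [Finset.sum_comm]
  refine Finset.sum_congr rfl fun j _ => ?_
  simp only [dotProduct, Matrix.vecMul, Matrix.map_apply, Finset.sum_mul]
  exact Finset.sum_comm

theorem isMiddleMatrix_middleMatrix {p : NC g} (hp : star p = p) :
    IsMiddleMatrix p (middleMatrix p) := by
  have hmem {j n : ℕ} (h : degree p ≤ n + j) (w : Word g (j + 1)) :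
      colTranspose (gradCoeff p j) w ∈ degLT (Fin g) n :=
    star_mem_degLT (leadWord_mem_degLT _ w
      (degLT_mono (by omega : degree p + 1 ≤ n + (j + 1)) (mem_degLT_degree p)))
  refine ⟨fun i j hij => ?_, ?_⟩
  · ext v w : 2
    simp only [middleMatrix, Matrix.zero_apply]
    rw [leadWord_eq_zero (m := i + 1) v (hmem (by omega) w) le_rfl, smul_zero]
  · rw [middle_form_eq]
    -- In degree 0 the truncated `degree p - 1` is 0, so the sum is empty and the Hessian must
    -- vanish.
    rcases Nat.eq_zero_or_pos (degree p) with h0 | hpos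
    · have := mem_degLT_degree p
      rw [h0] at this ⊢
      simpa using hessian_eq_zero_of_mem_degLT_one this
    · obtain ⟨n, hn⟩ : ∃ n, degree p = n + 1 := ⟨degree p - 1, by omega⟩
      have hpn := mem_degLT_degree p
      rw [hn] at hpn
      rw [hessian_eq_sum_border n hpn, hp, hn, Nat.add_sub_cancel]
      refine Finset.sum_congr rfl fun j _ => Finset.sum_congr rfl fun w _ => ?_
      congr 1
      -- The bound is not sharp for `j > 0`, but it gives every `j` the same range of `i`, as the
      -- square block sum requires.
      have := grad_eq_sum_borderRow n (hmem (by omega : degree p ≤ n + 1 + j) w)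
      change (2 : ℝ) • grad (colTranspose (gradCoeff p j) w) = _
      rw [this]
      simp only [middleMatrix, map_smul, mul_smul_comm, Finset.smul_sum]

/-- Cancel `V_j` on the right, then `V_iᵀ` on the left. -/
theorem IsMiddleMatrix.unique {p : NC g} {Z Y : BlockFamily g} (hZ : IsMiddleMatrix p Z)
    (hY : IsMiddleMatrix p Y) : Z = Y := by
  funext i j
  by_cases hij : degree p < i + j + 2
  · rw [hZ.1 i j hij, hY.1 i j hij]
  · have h := hZ.2.symm.trans hY.2
    rw [middle_form_eq, middle_form_eq] at h
    have h₁ := sum_border_injective _ _ _ h j (by omega)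
    ext v w : 2
    have h₂ := sum_borderRow_injective _ (fun i v => incl g (Z i j v w))
      (fun i v => incl g (Y i j v w)) (congrFun h₁ w) i (by omega)
    exact incl_injective (congrFun h₂ v)

/-- This is `eq_evalZero_add_sum` applied to each entry of `ψ_sᵀ`; the `1/2` cancels the 2 in
`middleMatrix`, and reversing words preserves the constant term. -/
theorem colTranspose_gradCoeff (p : NC g) (s : ℕ) :
    colTranspose (gradCoeff p s) =
      (1 / 2 : ℝ) • (xRow g ᵥ* middleMatrix p 0 s) + colTranspose (vecZero (gradCoeff p s)) := by
  have hstar (q : NC g) : evalZero (star q) = evalZero q := by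
    induction q using FreeAlgebra.induction with
    | grade0 r => simp [evalZero]
    | grade1 a => simp [evalZero]
    | mul p q hp hq =>
      simp only [evalZero, star_mul, map_mul] at hp hq ⊢
      rw [hp, hq, mul_comm]
    | add p q hp hq =>
      simp only [evalZero, star_add, map_add] at hp hq ⊢
      rw [hp, hq]
  funext w
  have hsum : (xRow g ᵥ* middleMatrix p 0 s) w =
      (2 : ℝ) • ∑ a, FreeAlgebra.ι ℝ a * lead a (colTranspose (gradCoeff p s) w) := by
    simp only [Matrix.vecMul, dotProduct, middleMatrix, mul_smul_comm, ← Finset.smul_sum]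
    rw [← (Equiv.funUnique (Fin 1) (Fin g)).symm.sum_comp]
    congr 1
  rw [Pi.add_apply, Pi.smul_apply, hsum, smul_smul]
  norm_num
  nth_rw 1 [eq_evalZero_add_sum (colTranspose (gradCoeff p s) w)]
  rw [add_comm]
  congr 1
  simp [colTranspose, vecZero, hstar]

end Coefficients

end NCPoly

theorem theoremA1 (g d : ℕ) (p : NCPoly.NC g) (hp : star p = p) (hd : NCPoly.degree p = d) :
    (∃! ψ : NCPoly.ColFamily g, NCPoly.IsGradCoeff p ψ) ∧
    (∃! Z : NCPoly.BlockFamily g, NCPoly.IsMiddleMatrix p Z) ∧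
    ∀ (ψ : NCPoly.ColFamily g) (Z : NCPoly.BlockFamily g),
      NCPoly.IsGradCoeff p ψ → NCPoly.IsMiddleMatrix p Z →
      ∀ s < d, NCPoly.colTranspose (ψ s) =
        (1 / 2 : ℝ) • (NCPoly.xRow g ᵥ* Z 0 s) + NCPoly.colTranspose (NCPoly.vecZero (ψ s)) := by
  have hψ := NCPoly.isGradCoeff_gradCoeff hp
  have hZ := NCPoly.isMiddleMatrix_middleMatrix hp
  refine ⟨⟨_, hψ, fun φ hφ => hφ.unique hψ⟩, ⟨_, hZ, fun Y hY => hY.unique hZ⟩, ?_⟩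
  intro φ Y hφ hY s _
  rw [hφ.unique hψ, hY.unique hZ]
  exact NCPoly.colTranspose_gradCoeff p s
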